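/- Let $n\ge 1$, write $z=(z',z_n)\in\mathbb{C}^{n-1}\times\mathbb{C}$ for $z\in\mathbb{C}^n$, and put $\rho(z)=\operatorname{Im} z_n-|z'|^2$ and $\mathbf{i}=(0',i)$. Let $\mathcal{U}=\{z\in\mathbb{C}^n:\rho(z)>0\}$ be the Siegel upper half-space, with boundary $b\mathcal{U}=\{z\in\mathbb{C}^n:\rho(z)=0\}$, and let $\beta$ be the measure on $b\mathcal{U}$ given by $$\int_{b\mathcal{U}} g\,d\beta=\int_{\mathbb{C}^{n-1}\times\mathbb{R}} g(z',x+i|z'|^2)\,dz'\,dx .$$ For $\lambda>-1$ let $dV_\lambda(z)=c_\lambda\,\rho(z)^\lambda\,dV(z)$ on $\mathcal{U}$, where $dV$ is Lebesgue measure on $\mathbb{C}^n$ and $c_\lambda=\dfrac{\Gamma(n+1+\lambda)}{4\pi^n\,\Gamma(1+\lambda)}$, and let $A^1_\lambda(\mathcal{U})$ be the space of holomorphic functions $f$ on $\mathcal{U}$ with $\int_{\mathcal{U}}|f|\,dV_\lambda<\infty$. **Theorem.** Let $\lambda>-1$ and $f\in A^1_\lambda(\mathcal{U})$. Then for every $t>0$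 the function $u\mapsto f(u+t\,\mathbf{i})$ is $\beta$-integrable on $b\mathcal{U}$ and $$\int_{b\mathcal{U}} f(u+t\,\mathbf{i})\,d\beta(u)=0 .$$ Consequently, $$\int_{\mathcal{U}} f\,dV_\lambda=0 .$$ -/

import Mathlib

open MeasureTheory

namespace Siegel

noncomputable section

/-! Throughout, `n = m + 1 ≥ 1`, and `ℂⁿ` is `Fin (m + 1) → ℂ`, whose `volume` is Lebesgue measure.
A point is `z = (z', z_n)` with `z' = (z_j)_{j < m}` and `z_n` the last coordinate.  The sup norm of
the function space is never used: `|z'|²` is written out as a sum of squares. -/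

/-- The squared Euclidean norm `|z'|² = ∑ |z_j|²` on `ℂᵐ`. -/
def sqNorm {m : ℕ} (z' : Fin m → ℂ) : ℝ := ∑ j, ‖z' j‖ ^ 2

/-- The defining function `ρ(z) = Im z_n - |z'|²`. -/
def rho {m : ℕ} (z : Fin (m + 1) → ℂ) : ℝ :=
  (z (Fin.last m)).im - sqNorm (fun j : Fin m => z j.castSucc)

/-- The Siegel upper half-space `𝒰 = {z ∈ ℂⁿ : ρ(z) > 0}`, `n = m + 1`. -/
def upperHalfSpace (m : ℕ) : Set (Fin (m + 1) → ℂ) := {z | 0 < rho z}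

/-- The boundary `b𝒰 = {z ∈ ℂⁿ : ρ(z) = 0}`. -/
def boundary (m : ℕ) : Set (Fin (m + 1) → ℂ) := {z | rho z = 0}

/-- The point `𝐢 = (0', i)`. -/
def iPoint (m : ℕ) : Fin (m + 1) → ℂ := Fin.snoc (α := fun _ => ℂ) 0 Complex.I

/-- The parametrization `(z', x) ↦ (z', x + i|z'|²)` of `b𝒰` by `ℂⁿ⁻¹ × ℝ`. -/
def boundaryParam (m : ℕ) (p : (Fin m → ℂ) × ℝ) : Fin (m + 1) → ℂ :=
  Fin.snoc (α := fun _ => ℂ) p.1 ((p.2 : ℂ) + Complex.I * (sqNorm p.1 : ℂ))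

/-- The measure `β` on `b𝒰`: the image of Lebesgue measure `dz' dx` on `ℂⁿ⁻¹ × ℝ` under
`(z', x) ↦ (z', x + i|z'|²)`. -/
def boundaryMeasure (m : ℕ) : Measure (Fin (m + 1) → ℂ) :=
  (volume : Measure ((Fin m → ℂ) × ℝ)).map (boundaryParam m)

/-- The constant `c_λ = Γ(n + 1 + λ) / (4 πⁿ Γ(1 + λ))`, `n = m + 1`. -/
def weightConst (m : ℕ) (lam : ℝ) : ℝ :=
  Real.Gamma (((m + 1 : ℕ) : ℝ) + 1 + lam) / (4 * Real.pi ^ (m + 1) * Real.Gamma (1 + lam))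

/-- The measure `dV_λ(z) = c_λ ρ(z)^λ dV(z)` on `𝒰`. -/
def weightedVolume (m : ℕ) (lam : ℝ) : Measure (Fin (m + 1) → ℂ) :=
  (volume.restrict (upperHalfSpace m)).withDensity
    (fun z => ENNReal.ofReal (weightConst m lam * rho z ^ lam))

/-- `f ∈ A^p_λ(𝒰)`: `f` is holomorphic on `𝒰` and `∫_𝒰 |f|^p dV_λ < ∞`. -/
structure MemBergman (m : ℕ) (p lam : ℝ) (f : (Fin (m + 1) → ℂ) → ℂ) : Prop where
  holomorphic : DifferentiableOn ℂ f (upperHalfSpace m)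
  lintegral_lt_top : ∫⁻ z in upperHalfSpace m, ‖f z‖ₑ ^ p ∂(weightedVolume m lam) < ⊤

/-- The parametrization is measurable, so that the image measure `β` is the intended one. -/
theorem measurable_boundaryParam (m : ℕ) : Measurable (boundaryParam m) := by
  refine measurable_pi_lambda _ fun i => ?_
  refine Fin.lastCases ?_ (fun j => ?_) i
  · simp only [boundaryParam, Fin.snoc_last, sqNorm]
    fun_prop
  · simp only [boundaryParam, Fin.snoc_castSucc]
    fun_prop

end

end Siegel

/-! ### One variable: horizontal line integrals in the upper half-plane -/

namespace Siegel

open Set Metric Filter Topology Complex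

/-! Everything reduces to one variable. In the coordinates `(z', x, y)` with last entry `x + i(|z'|²
+ y)`, Lebesgue measure is `dz' dx dy` and `ρ = y`. By Tonelli, almost every slice `g` of `f` over
fixed `z'` is holomorphic on the upper half-plane with `∫ y^λ ∫ |g(x + iy)| dx dy` finite.

For such `g`, the sub-mean value property gives integrability on each line
(`exists_lintegral_line_le`), and Cauchy's theorem on rectangles makes the line integral independent
of the height (`integral_line_eq`). Its constant modulus times `∫₀^∞ y^λ dy = ∞` is then finite, so
it vanishes (`integral_line_eq_zero`). Integrating over `z'` gives the boundary statement, and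
integrating that over the height gives the statement on `𝒰`. -/

theorem enorm_le_lintegral_circle {g : ℂ → ℂ} {c : ℂ} {r : ℝ} (hr : 0 < r)
    (hg : DifferentiableOn ℂ g (closedBall c r)) :
    ENNReal.ofReal (2 * Real.pi) * ‖g c‖ₑ
      ≤ ∫⁻ θ in Ioo (-Real.pi) Real.pi, ‖g (c + r * (Real.cos θ + Real.sin θ * I))‖ₑ := by
  have hd : DiffContOnCl ℂ g (ball c |r|) := by
    rw [abs_of_pos hr]
    exact DifferentiableOn.diffContOnCl (hg.mono closure_ball_subset_closedBall)
  have h1 := hd.circleAverage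
  -- Starting at `-π` matches the angular range of polar coordinates.
  rw [Real.circleAverage_eq_integral_add (-Real.pi),
    intervalIntegral.integral_comp_add_right (fun θ => g (circleMap c r θ))] at h1
  have h2 : ((2 * Real.pi : ℝ)) • g c = ∫ θ in (-Real.pi)..Real.pi, g (circleMap c r θ) := by
    rw [← h1, smul_smul, mul_inv_cancel₀ Real.two_pi_pos.ne', one_smul]
    congr 1 <;> ring
  have h3 : ENNReal.ofReal (2 * Real.pi) * ‖g c‖ₑ = ‖((2 * Real.pi : ℝ)) • g c‖ₑ := by
    rw [enorm_smul, Real.enorm_of_nonneg Real.two_pi_pos.le]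
  rw [h3, h2, intervalIntegral.integral_of_le (by linarith [Real.pi_pos]),
    integral_Ioc_eq_integral_Ioo]
  refine (enorm_integral_le_lintegral_enorm _).trans (le_of_eq ?_)
  refine lintegral_congr fun θ => ?_
  simp only [circleMap, exp_mul_I, ofReal_cos, ofReal_sin]

/-- The sub-mean value property of the modulus of a holomorphic function, over discs. -/
theorem enorm_le_lintegral_ball {g : ℂ → ℂ} (hgm : Measurable g) {c : ℂ} {r : ℝ}
    (hr : 0 < r) (hg : DifferentiableOn ℂ g (ball c r)) :
    ENNReal.ofReal (Real.pi * r ^ 2) * ‖g c‖ₑ ≤ ∫⁻ w in ball 0 r, ‖g (c + w)‖ₑ := by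
  rw [← lintegral_indicator measurableSet_ball, ← Complex.lintegral_comp_polarCoord_symm,
    polarCoord_target, Measure.volume_eq_prod, ← Measure.prod_restrict, lintegral_prod]
  swap
  · refine Measurable.aemeasurable ?_
    simp only [Complex.polarCoord_symm_apply]
    refine Measurable.smul (ENNReal.measurable_ofReal.comp measurable_fst) ?_
    have hm : Measurable ((ball (0 : ℂ) r).indicator fun w => ‖g (c + w)‖ₑ) :=
      Measurable.indicator (by fun_prop) measurableSet_ball
    exact hm.comp (by fun_prop)
  calc ENNReal.ofReal (Real.pi * r ^ 2) * ‖g c‖ₑ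
      = ∫⁻ s in Ioo 0 r, ENNReal.ofReal s * (ENNReal.ofReal (2 * Real.pi) * ‖g c‖ₑ) := by
        rw [lintegral_mul_const _ (by fun_prop), ← mul_assoc,
          ← ofReal_integral_eq_lintegral_ofReal, ← integral_Ioc_eq_integral_Ioo,
          ← intervalIntegral.integral_of_le hr.le, integral_id,
          ← ENNReal.ofReal_mul' Real.two_pi_pos.le]
        · congr 2; ring
        · exact (continuous_id.integrableOn_Icc (a := 0) (b := r)).mono_set Ioo_subset_Icc_self
        · exact (ae_restrict_iff' measurableSet_Ioo).2 (ae_of_all _ fun s hs => hs.1.le)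
    _ ≤ ∫⁻ s in Ioo 0 r, ∫⁻ θ in Ioo (-Real.pi) Real.pi, ENNReal.ofReal s •
          (ball (0 : ℂ) r).indicator (fun w => ‖g (c + w)‖ₑ) (Complex.polarCoord.symm (s, θ)) := by
        refine setLIntegral_mono' measurableSet_Ioo fun s hs => ?_
        simp only [smul_eq_mul]
        rw [lintegral_const_mul' _ _ ENNReal.ofReal_ne_top]
        gcongr
        refine (enorm_le_lintegral_circle hs.1
          (hg.mono (closedBall_subset_ball hs.2))).trans (le_of_eq ?_)
        refine lintegral_congr fun θ => ?_
        rw [indicator_of_mem]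
        · simp [Complex.polarCoord_symm_apply]
        · rw [mem_ball_zero_iff, Complex.norm_polarCoord_symm, abs_of_pos hs.1]
          exact hs.2
    _ ≤ _ := lintegral_mono_set Ioo_subset_Ioi_self

theorem measurePreserving_add_mul_I :
    MeasurePreserving (fun q : ℝ × ℝ => (q.1 + q.2 * I : ℂ)) := by
  convert Complex.volume_preserving_equiv_real_prod.symm using 2 with q
  apply Complex.ext <;> simp

/-- The `L¹` norm over a horizontal line is controlled by the `L¹` norm over a strip. -/
theorem lintegral_line_le_strip {g : ℂ → ℂ} (hgm : Measurable g)
    (hg : DifferentiableOn ℂ g {w | 0 < w.im}) {t : ℝ} (ht : 0 < t) :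
    ENNReal.ofReal (Real.pi * (t / 2) ^ 2) * ∫⁻ x : ℝ, ‖g (x + t * I)‖ₑ
      ≤ ENNReal.ofReal t * ∫⁻ y in Ioc (t / 2) (2 * t), ∫⁻ x : ℝ, ‖g (x + y * I)‖ₑ := by
  have hH : Measurable fun y : ℝ => ∫⁻ x : ℝ, ‖g (x + y * I)‖ₑ :=
    Measurable.lintegral_prod_left' (f := fun q : ℝ × ℝ => ‖g (q.1 + q.2 * I)‖ₑ) (by fun_prop)
  calc _ ≤ ∫⁻ x : ℝ, ∫⁻ w in ball (0 : ℂ) (t / 2), ‖g (x + t * I + w)‖ₑ := by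
        rw [← lintegral_const_mul' _ _ ENNReal.ofReal_ne_top]
        refine lintegral_mono fun x => enorm_le_lintegral_ball hgm (by positivity) (hg.mono ?_)
        intro w hw
        have h1 := (abs_im_le_norm (w - (x + t * I))).trans_lt (mem_ball_iff_norm.1 hw)
        simp only [sub_im, add_im, ofReal_im, mul_im, ofReal_re, I_im, I_re] at h1
        rw [mem_ofPred_eq]
        linarith [(abs_lt.1 h1).1]
    _ = ∫⁻ w in ball (0 : ℂ) (t / 2), ∫⁻ x : ℝ, ‖g (x + t * I + w)‖ₑ :=
        lintegral_lintegral_swap (by fun_prop)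
    _ = ∫⁻ w in ball (0 : ℂ) (t / 2), ∫⁻ x : ℝ, ‖g (x + (t + w.im : ℝ) * I)‖ₑ := by
        refine lintegral_congr fun w => ?_
        -- Translation in `x` absorbs `Re w`, leaving a function of the height alone.
        rw [← lintegral_add_right_eq_self (μ := volume)
          (fun x : ℝ => ‖g (x + (t + w.im : ℝ) * I)‖ₑ) w.re]
        refine lintegral_congr fun x => ?_
        congr 2
        apply Complex.ext <;> simp
    -- Passing from the disc to its circumscribed square separates the variables; the horizontal
    -- side gives the factor `t`.
    _ ≤ ∫⁻ w in {w : ℂ | w.re ∈ Ioo (-(t / 2)) (t / 2) ∧ w.im ∈ Ioo (-(t / 2)) (t / 2)},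
          ∫⁻ x : ℝ, ‖g (x + (t + w.im : ℝ) * I)‖ₑ := by
        refine lintegral_mono_set fun w hw => ?_
        rw [mem_ball_zero_iff] at hw
        exact ⟨abs_lt.1 ((abs_re_le_norm w).trans_lt hw),
          abs_lt.1 ((abs_im_le_norm w).trans_lt hw)⟩
    _ = ∫⁻ q in Ioo (-(t / 2)) (t / 2) ×ˢ Ioo (-(t / 2)) (t / 2),
          ∫⁻ x : ℝ, ‖g (x + (t + q.2 : ℝ) * I)‖ₑ := by
        rw [← measurePreserving_add_mul_I.setLIntegral_comp_preimage]
        · simp; rfl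
        · exact (measurable_re measurableSet_Ioo).inter (measurable_im measurableSet_Ioo)
        · exact hH.comp (by fun_prop)
    _ = ENNReal.ofReal t * ∫⁻ y in Ioo (-(t / 2)) (t / 2),
          ∫⁻ x : ℝ, ‖g (x + (t + y : ℝ) * I)‖ₑ := by
        rw [Measure.volume_eq_prod, ← Measure.prod_restrict, lintegral_prod]
        · simp [mul_comm]
        · exact (hH.comp (f := fun q : ℝ × ℝ => t + q.2) (by fun_prop)).aemeasurable
    _ ≤ _ := by
        refine mul_le_mul_right ?_ _
        rw [← lintegral_indicator measurableSet_Ioc, ← lintegral_indicator measurableSet_Ioo,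
          ← lintegral_add_left_eq_self (μ := volume) ((Ioc (t / 2) (2 * t)).indicator _) t]
        refine lintegral_mono (indicator_le fun y hy => ?_)
        rw [indicator_of_mem]
        exact ⟨by linarith [hy.1], by linarith [hy.2]⟩

/-- Since `y ^ lam` is monotone or antitone, its smaller endpoint value bounds it below on the
strip. -/
theorem exists_lintegral_strip_le (lam : ℝ) {s t : ℝ} (hs : 0 < s) (hst : s < t) :
    ∃ C : ENNReal, C ≠ ⊤ ∧ ∀ H : ℝ → ENNReal, ∫⁻ y in Ioc s t, H y
      ≤ C * ∫⁻ y in Ioi (0 : ℝ), ENNReal.ofReal (y ^ lam) * H y := by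
  have hpos : 0 < min (s ^ lam) (t ^ lam) :=
    lt_min (Real.rpow_pos_of_pos hs _) (Real.rpow_pos_of_pos (hs.trans hst) _)
  refine ⟨(ENNReal.ofReal (min (s ^ lam) (t ^ lam)))⁻¹, by simpa using hpos, fun H => ?_⟩
  rw [← ENNReal.mul_le_iff_le_inv (by simpa using hpos) ENNReal.ofReal_ne_top,
    ← lintegral_const_mul' _ _ ENNReal.ofReal_ne_top]
  refine (setLIntegral_mono' measurableSet_Ioc fun y hy => ?_).trans
    (lintegral_mono_set fun y hy => hs.trans hy.1)
  gcongr
  rcases le_total 0 lam with h | h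
  · exact (min_le_left _ _).trans (Real.rpow_le_rpow hs.le hy.1.le h)
  · exact (min_le_right _ _).trans (Real.rpow_le_rpow_of_nonpos (hs.trans hy.1) hy.2 h)

/-- The constant is chosen before `g`, so the bound can later be integrated over all slices. -/
theorem exists_lintegral_line_le (lam : ℝ) {t : ℝ} (ht : 0 < t) :
    ∃ C : ENNReal, C ≠ ⊤ ∧ ∀ g : ℂ → ℂ, Measurable g → DifferentiableOn ℂ g {w | 0 < w.im} →
      ∫⁻ x : ℝ, ‖g (x + t * I)‖ₑ
        ≤ C * ∫⁻ y in Ioi (0 : ℝ), ENNReal.ofReal (y ^ lam) * ∫⁻ x : ℝ, ‖g (x + y * I)‖ₑ := by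
  obtain ⟨C, hC, h⟩ := exists_lintegral_strip_le lam (half_pos ht) (by linarith : t / 2 < 2 * t)
  have hpos : 0 < Real.pi * (t / 2) ^ 2 := by positivity
  refine ⟨(ENNReal.ofReal (Real.pi * (t / 2) ^ 2))⁻¹ * (ENNReal.ofReal t * C),
    ENNReal.mul_ne_top (by simpa using hpos) (ENNReal.mul_ne_top ENNReal.ofReal_ne_top hC),
    fun g hgm hg => ?_⟩
  rw [mul_assoc, ← ENNReal.mul_le_iff_le_inv (by simpa using hpos) ENNReal.ofReal_ne_top, mul_assoc]
  exact (lintegral_line_le_strip hgm hg ht).trans (by gcongr; exact h _)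

theorem integral_line_eq {g : ℂ → ℂ} (hgm : Measurable g)
    (hg : DifferentiableOn ℂ g {w | 0 < w.im}) {s t : ℝ} (hs : 0 < s) (hst : s < t)
    (his : Integrable fun x : ℝ => g (x + s * I)) (hit : Integrable fun x : ℝ => g (x + t * I))
    (hfin : ∫⁻ y in Ioc s t, ∫⁻ x : ℝ, ‖g (x + y * I)‖ₑ < ⊤) :
    ∫ x : ℝ, g (x + s * I) = ∫ x : ℝ, g (x + t * I) := by
  have hprod : Integrable (fun q : ℝ × ℝ => g (q.1 + q.2 * I))
      ((volume : Measure ℝ).prod (volume.restrict (Ioc s t))) := by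
    refine ⟨(Measurable.aestronglyMeasurable (by fun_prop)), ?_⟩
    rw [HasFiniteIntegral, lintegral_prod_symm _ (by fun_prop)]
    exact hfin
  have hv := hprod.integral_prod_left
  have hv' : Integrable fun R : ℝ => I • (∫ y in Ioc s t, g ((-R : ℝ) + y * I))
      - I • ∫ y in Ioc s t, g (R + y * I) := (hv.comp_neg.smul I).sub (hv.smul I)
  have hlim := (intervalIntegral_tendsto_integral his tendsto_neg_atTop_atBot tendsto_id).sub
    (intervalIntegral_tendsto_integral hit tendsto_neg_atTop_atBot tendsto_id)
  rw [← sub_eq_zero]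
  -- By Cauchy, the difference of the horizontal sides over `[-R, R]` equals the vertical
  -- contribution, which is integrable in `R`. An integrable function with a limit at infinity has
  -- limit zero.
  refine IntegrableAtFilter.eq_zero_of_tendsto (μ := volume) (l := atTop)
    (hv'.integrableAtFilter _) (fun u hu => ?_) (hlim.congr fun R => ?_)
  · obtain ⟨b, hb⟩ := mem_atTop_sets.1 hu
    rw [← top_le_iff, ← Real.volume_Ici (a := b)]
    exact measure_mono hb
  · have hrect := Complex.integral_boundary_rect_eq_zero_of_differentiableOn g
      ((-R : ℝ) + s * I) (R + t * I) (hg.mono fun w hw => by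
        have := hw.2
        simp [uIcc_of_le hst.le] at this
        exact hs.trans_le this.1)
    simp only [add_re, ofReal_re, mul_re, I_re, mul_zero, ofReal_im, I_im, mul_one, sub_self,
      add_zero, add_im, mul_im, zero_add, intervalIntegral.integral_of_le hst.le] at hrect
    simp only [id]
    linear_combination hrect

/-- A holomorphic function on the upper half-plane that is integrable for the weight `y ^ lam` has
vanishing integral over every horizontal line. -/
theorem integral_line_eq_zero {g : ℂ → ℂ} (lam : ℝ) (hgm : Measurable g)
    (hg : DifferentiableOn ℂ g {w | 0 < w.im})
    (hfin : ∫⁻ y in Ioi (0 : ℝ), ENNReal.ofReal (y ^ lam) * ∫⁻ x : ℝ, ‖g (x + y * I)‖ₑ < ⊤)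
    {t : ℝ} (ht : 0 < t) : ∫ x : ℝ, g (x + t * I) = 0 := by
  have hint : ∀ s : ℝ, 0 < s → Integrable fun x : ℝ => g (x + s * I) := fun s hs => by
    obtain ⟨C, hC, h⟩ := exists_lintegral_line_le lam hs
    exact ⟨Measurable.aestronglyMeasurable (by fun_prop),
      (h g hgm hg).trans_lt (ENNReal.mul_lt_top hC.lt_top hfin)⟩
  have hlt : ∀ a b : ℝ, 0 < a → a < b →
      ∫ x : ℝ, g (x + a * I) = ∫ x : ℝ, g (x + b * I) := fun a b ha hab => by
    obtain ⟨C, hC, h⟩ := exists_lintegral_strip_le lam ha hab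
    exact integral_line_eq hgm hg ha hab (hint a ha) (hint b (ha.trans hab))
      ((h _).trans_lt (ENNReal.mul_lt_top hC.lt_top hfin))
  have hconst : ∀ y : ℝ, 0 < y → ∫ x : ℝ, g (x + y * I) = ∫ x : ℝ, g (x + t * I) := by
    intro y hy
    rcases lt_trichotomy y t with h | rfl | h
    · exact hlt y t hy h
    · rfl
    · exact (hlt t y ht h).symm
  by_contra hne
  -- No real power is integrable on all of `(0, ∞)`: it diverges at `0` or at infinity.
  refine not_integrableOn_Ioi_rpow lam ⟨by fun_prop, ?_⟩
  have hle : (∫⁻ y in Ioi (0 : ℝ), ENNReal.ofReal (y ^ lam)) * ‖∫ x : ℝ, g (x + t * I)‖ₑ < ⊤ := by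
    rw [← lintegral_mul_const' _ _ enorm_ne_top]
    refine (setLIntegral_mono' measurableSet_Ioi fun y hy => ?_).trans_lt hfin
    gcongr
    rw [← hconst y hy]
    exact enorm_integral_le_lintegral_enorm _
  have h0 := ENNReal.lt_top_of_mul_ne_top_left hle.ne (by simpa using hne)
  refine lt_of_eq_of_lt (setLIntegral_congr_fun measurableSet_Ioi fun y hy => ?_) h0
  exact Real.enorm_of_nonneg (Real.rpow_nonneg (le_of_lt hy) _)

end Siegel
-- Coordinates adapted to the Siegel half-space
namespace Siegel

open Set

theorem boundaryParam_add_smul_iPoint (m : ℕ) (p : (Fin m → ℂ) × ℝ) (y : ℝ) :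
    boundaryParam m p + y • iPoint m = Fin.snoc (α := fun _ => ℂ) p.1
      ((p.2 + y * Complex.I) + Complex.I * (sqNorm p.1 : ℂ)) := by
  funext i
  refine Fin.lastCases ?_ (fun j => ?_) i
  · simp [boundaryParam, iPoint]; ring
  · simp [boundaryParam, iPoint]

theorem rho_boundaryParam_add_smul_iPoint (m : ℕ) (p : (Fin m → ℂ) × ℝ) (y : ℝ) :
    rho (boundaryParam m p + y • iPoint m) = y := by
  rw [boundaryParam_add_smul_iPoint]
  simp [rho]

theorem continuous_sqNorm (m : ℕ) : Continuous (sqNorm (m := m)) := by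
  unfold sqNorm; fun_prop

theorem continuous_rho (m : ℕ) : Continuous (rho (m := m)) := by
  unfold rho sqNorm; fun_prop

theorem isOpen_upperHalfSpace (m : ℕ) : IsOpen (upperHalfSpace m) :=
  isOpen_lt continuous_const (continuous_rho m)

theorem measurable_boundaryParam_add_smul_iPoint (m : ℕ) :
    Measurable fun q : ((Fin m → ℂ) × ℝ) × ℝ => boundaryParam m q.1 + q.2 • iPoint m :=
  ((measurable_boundaryParam m).comp measurable_fst).add (measurable_snd.smul_const _)

/-- The coordinates `(z', x, y) ↦ (z', x + i(|z'|² + y))` preserve Lebesgue measure. -/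
theorem measurePreserving_boundaryParam_add_smul_iPoint (m : ℕ) :
    MeasurePreserving
      fun q : ((Fin m → ℂ) × ℝ) × ℝ => boundaryParam m q.1 + q.2 • iPoint m := by
  have h1 : MeasurePreserving (MeasurableEquiv.prodAssoc : ((Fin m → ℂ) × ℝ) × ℝ ≃ᵐ _) :=
    volume_preserving_prodAssoc
  -- A shear: for each `z'` the last coordinate is merely translated.
  have h2 : MeasurePreserving fun q : (Fin m → ℂ) × ℂ =>
      (q.1, q.2 + Complex.I * (sqNorm q.1 : ℂ)) := by
    refine (MeasurePreserving.id volume).skew_product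
      (g := fun (z : Fin m → ℂ) (w : ℂ) => w + Complex.I * (sqNorm z : ℂ)) ?_ ?_
    · have := (continuous_sqNorm m).measurable
      unfold Function.uncurry
      fun_prop
    · exact Filter.Eventually.of_forall fun z => (measurePreserving_add_right volume _).map_eq
  have h3 := (volume_preserving_piFinSuccAbove (fun _ : Fin (m + 1) => ℂ) (Fin.last m)).symm
  have h4 := (h3.comp Measure.measurePreserving_swap).comp
    ((h2.comp ((MeasurePreserving.id (volume : Measure (Fin m → ℂ))).prod
      measurePreserving_add_mul_I)).comp h1)
  convert h4 using 1
  funext q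
  rw [boundaryParam_add_smul_iPoint]
  simp only [Function.comp_apply, Prod.swap_prod_mk, MeasurableEquiv.piFinSuccAbove_symm_apply,
    MeasurableEquiv.prodAssoc]
  exact (Fin.insertNth_last' _ _).symm

/-- The measure `c_λ y^λ dy` on `(0, ∞)`. -/
noncomputable def heightMeasure (m : ℕ) (lam : ℝ) : Measure ℝ :=
  (volume.restrict (Ioi 0)).withDensity fun y => ENNReal.ofReal (weightConst m lam * y ^ lam)

instance (m : ℕ) (lam : ℝ) : SFinite (heightMeasure m lam) := by
  unfold heightMeasure; infer_instance

theorem lintegral_heightMeasure (m : ℕ) (lam : ℝ) {h : ℝ → ENNReal} (hh : Measurable h) :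
    ∫⁻ y, h y ∂(heightMeasure m lam)
      = ∫⁻ y in Ioi 0, ENNReal.ofReal (weightConst m lam * y ^ lam) * h y :=
  lintegral_withDensity_eq_lintegral_mul _ (by fun_prop) hh

theorem weightedVolume_eq_map (m : ℕ) (lam : ℝ) :
    weightedVolume m lam = ((volume : Measure ((Fin m → ℂ) × ℝ)).prod (heightMeasure m lam)).map
      fun q => boundaryParam m q.1 + q.2 • iPoint m := by
  have hΨ := measurable_boundaryParam_add_smul_iPoint m
  have hr := (continuous_rho m).measurable
  have hU := (isOpen_upperHalfSpace m).measurableSet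
  refine Measure.ext_of_lintegral _ fun h hh => ?_
  rw [lintegral_map hh hΨ, lintegral_prod _ (by exact (hh.comp hΨ).aemeasurable), weightedVolume,
    lintegral_withDensity_eq_lintegral_mul _ (by fun_prop) hh, ← lintegral_indicator hU,
    ← (measurePreserving_boundaryParam_add_smul_iPoint m).lintegral_comp
      (Measurable.indicator (by fun_prop) hU), Measure.volume_eq_prod, lintegral_prod]
  swap
  · exact (Measurable.comp (Measurable.indicator (by fun_prop) hU) hΨ).aemeasurable
  refine lintegral_congr fun p => ?_
  have hp : Measurable fun y : ℝ => h (boundaryParam m p + y • iPoint m) :=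
    hh.comp (hΨ.comp measurable_prodMk_left)
  rw [lintegral_heightMeasure m lam hp,
    ← lintegral_indicator measurableSet_Ioi]
  refine lintegral_congr fun y => ?_
  simp only [indicator, upperHalfSpace, mem_ofPred_eq, mem_Ioi, rho_boundaryParam_add_smul_iPoint,
    Pi.mul_apply]

theorem weightConst_pos (m : ℕ) {lam : ℝ} (hlam : -1 < lam) : 0 < weightConst m lam := by
  have hm : (0 : ℝ) ≤ (m + 1 : ℕ) := Nat.cast_nonneg _
  have h1 := Real.Gamma_pos_of_pos (show 0 < ((m + 1 : ℕ) : ℝ) + 1 + lam by linarith)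
  have h2 := Real.Gamma_pos_of_pos (show 0 < 1 + lam by linarith)
  unfold weightConst
  positivity

/-! ### Slices and Fubini -/

/-- The slice `w ↦ f(z', w + i|z'|²)`, extended by zero to the complement of the upper
half-plane. -/
noncomputable def slice {m : ℕ} (f : (Fin (m + 1) → ℂ) → ℂ) (z' : Fin m → ℂ) (w : ℂ) : ℂ :=
  (upperHalfSpace m).indicator f
    (Fin.snoc (α := fun _ => ℂ) z' (w + Complex.I * (sqNorm z' : ℂ)))

theorem slice_apply {m : ℕ} (f : (Fin (m + 1) → ℂ) → ℂ) (p : (Fin m → ℂ) × ℝ) (y : ℝ) :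
    slice f p.1 (p.2 + y * Complex.I)
      = (upperHalfSpace m).indicator f (boundaryParam m p + y • iPoint m) := by
  rw [slice, ← boundaryParam_add_smul_iPoint]

/-- Nothing is known about `f` off `𝒰`; the cutoff supplies the global measurability Fubini needs.
-/
theorem measurable_indicator_upperHalfSpace {m : ℕ} {f : (Fin (m + 1) → ℂ) → ℂ}
    (hf : DifferentiableOn ℂ f (upperHalfSpace m)) :
    Measurable ((upperHalfSpace m).indicator f) := by
  classical
  rw [← piecewise_eq_indicator]
  exact hf.continuousOn.measurable_piecewise continuousOn_const
    (isOpen_upperHalfSpace m).measurableSet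

theorem measurable_slice {m : ℕ} {f : (Fin (m + 1) → ℂ) → ℂ}
    (hf : DifferentiableOn ℂ f (upperHalfSpace m)) :
    Measurable fun q : (Fin m → ℂ) × ℂ => slice f q.1 q.2 := by
  refine (measurable_indicator_upperHalfSpace hf).comp (measurable_pi_lambda _ fun i => ?_)
  have := (continuous_sqNorm m).measurable
  refine Fin.lastCases ?_ (fun j => ?_) i
  · simp only [Fin.snoc_last]
    fun_prop
  · simp only [Fin.snoc_castSucc]
    fun_prop

theorem differentiableOn_slice {m : ℕ} {f : (Fin (m + 1) → ℂ) → ℂ}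
    (hf : DifferentiableOn ℂ f (upperHalfSpace m)) (z' : Fin m → ℂ) :
    DifferentiableOn ℂ (slice f z') {w | 0 < w.im} := by
  have hmaps : MapsTo (fun w : ℂ => (Fin.snoc (α := fun _ => ℂ) z'
      (w + Complex.I * (sqNorm z' : ℂ)) : Fin (m + 1) → ℂ)) {w | 0 < w.im}
      (upperHalfSpace m) := fun w hw => by
    simpa [upperHalfSpace, rho] using hw
  have hd : Differentiable ℂ (fun w : ℂ => (Fin.snoc (α := fun _ => ℂ) z'
      (w + Complex.I * (sqNorm z' : ℂ)) : Fin (m + 1) → ℂ)) := by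
    refine differentiable_pi.2 fun i => ?_
    refine Fin.lastCases ?_ (fun j => ?_) i
    · simp only [Fin.snoc_last]
      fun_prop
    · simp only [Fin.snoc_castSucc]
      fun_prop
  exact (hf.comp hd.differentiableOn hmaps).congr fun w hw => indicator_of_mem (hmaps hw) f

theorem weightedVolume_restrict_upperHalfSpace (m : ℕ) (lam : ℝ) :
    (weightedVolume m lam).restrict (upperHalfSpace m) = weightedVolume m lam := by
  have hU := (isOpen_upperHalfSpace m).measurableSet
  rw [weightedVolume, restrict_withDensity hU, Measure.restrict_restrict hU, inter_self]

theorem lintegral_slice_heightMeasure_lt_top {m : ℕ} {lam : ℝ} {f : (Fin (m + 1) → ℂ) → ℂ}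
    (hf : MemBergman m 1 lam f) :
    ∫⁻ q : ((Fin m → ℂ) × ℝ) × ℝ, ‖slice f q.1.1 (q.1.2 + q.2 * Complex.I)‖ₑ
      ∂(volume.prod (heightMeasure m lam)) < ⊤ := by
  have hind := (measurable_indicator_upperHalfSpace hf.holomorphic).enorm
  simp only [slice_apply]
  rw [← lintegral_map hind (measurable_boundaryParam_add_smul_iPoint m), ← weightedVolume_eq_map,
    ← weightedVolume_restrict_upperHalfSpace]
  refine lt_of_eq_of_lt ?_ hf.lintegral_lt_top
  refine setLIntegral_congr_fun (isOpen_upperHalfSpace m).measurableSet fun z hz => ?_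
  simp [indicator_of_mem hz]

theorem measurable_slice_coord {m : ℕ} {f : (Fin (m + 1) → ℂ) → ℂ}
    (hf : DifferentiableOn ℂ f (upperHalfSpace m)) :
    Measurable fun q : ((Fin m → ℂ) × ℝ) × ℝ => slice f q.1.1 (q.1.2 + q.2 * Complex.I) :=
  (measurable_slice hf).comp (by fun_prop : Measurable fun q : ((Fin m → ℂ) × ℝ) × ℝ =>
    (q.1.1, (q.1.2 + q.2 * Complex.I : ℂ)))

theorem measurable_slice_line {m : ℕ} {f : (Fin (m + 1) → ℂ) → ℂ}
    (hf : DifferentiableOn ℂ f (upperHalfSpace m)) (y : ℝ) :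
    Measurable fun p : (Fin m → ℂ) × ℝ => slice f p.1 (p.2 + y * Complex.I) :=
  (measurable_slice_coord hf).comp (measurable_id.prodMk measurable_const)

theorem measurable_lintegral_slice {m : ℕ} {f : (Fin (m + 1) → ℂ) → ℂ}
    (hf : DifferentiableOn ℂ f (upperHalfSpace m)) :
    Measurable fun q : (Fin m → ℂ) × ℝ => ∫⁻ x : ℝ, ‖slice f q.1 (x + q.2 * Complex.I)‖ₑ :=
  Measurable.lintegral_prod_right'
    (f := fun q : ((Fin m → ℂ) × ℝ) × ℝ => ‖slice f q.1.1 (q.2 + q.1.2 * Complex.I)‖ₑ)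
    ((measurable_slice_coord hf).comp (by fun_prop : Measurable
      fun q : ((Fin m → ℂ) × ℝ) × ℝ => ((q.1.1, q.2), q.1.2))).enorm

/-- Tonelli with `z'` outermost, then division by `c_λ`; `λ > -1` serves to make `c_λ` positive. -/
theorem lintegral_slice_lt_top {m : ℕ} {lam : ℝ} (hlam : -1 < lam) {f : (Fin (m + 1) → ℂ) → ℂ}
    (hf : MemBergman m 1 lam f) :
    ∫⁻ z' : Fin m → ℂ, ∫⁻ y in Ioi (0 : ℝ), ENNReal.ofReal (y ^ lam) *
      ∫⁻ x : ℝ, ‖slice f z' (x + y * Complex.I)‖ₑ < ⊤ := by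
  have hc := weightConst_pos m hlam
  have hH := measurable_lintegral_slice hf.holomorphic
  have hfin := lintegral_slice_heightMeasure_lt_top hf
  rw [lintegral_prod_symm _ (measurable_slice_coord hf.holomorphic).enorm.aemeasurable] at hfin
  refine ENNReal.lt_top_of_mul_ne_top_right (a := ENNReal.ofReal (weightConst m lam))
    (ne_of_lt (lt_of_eq_of_lt ?_ hfin)) (by simpa using hc)
  calc _ = ∫⁻ z' : Fin m → ℂ, ∫⁻ y : ℝ, (∫⁻ x : ℝ, ‖slice f z' (x + y * Complex.I)‖ₑ)
          ∂(heightMeasure m lam) := by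
        rw [← lintegral_const_mul' _ _ ENNReal.ofReal_ne_top]
        refine lintegral_congr fun z' => ?_
        have hHz := hH.comp (measurable_prodMk_left (x := z'))
        simp only [Function.comp_def] at hHz
        rw [lintegral_heightMeasure m lam hHz,
          ← lintegral_const_mul' _ _ ENNReal.ofReal_ne_top]
        refine lintegral_congr fun y => ?_
        rw [ENNReal.ofReal_mul hc.le, mul_assoc]
    _ = ∫⁻ y : ℝ, (∫⁻ z' : Fin m → ℂ, ∫⁻ x : ℝ, ‖slice f z' (x + y * Complex.I)‖ₑ)
          ∂(heightMeasure m lam) := lintegral_lintegral_swap hH.aemeasurable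
    _ = _ := by
        refine lintegral_congr fun y => ?_
        rw [Measure.volume_eq_prod,
          lintegral_prod _ (measurable_slice_line hf.holomorphic y).enorm.aemeasurable]

theorem integrable_slice_line {m : ℕ} {lam : ℝ} (hlam : -1 < lam) {f : (Fin (m + 1) → ℂ) → ℂ}
    (hf : MemBergman m 1 lam f) {t : ℝ} (ht : 0 < t) :
    Integrable fun p : (Fin m → ℂ) × ℝ => slice f p.1 (p.2 + t * Complex.I) := by
  have hm := measurable_slice_line hf.holomorphic t
  obtain ⟨C, hC, h⟩ := exists_lintegral_line_le lam ht
  refine ⟨hm.aestronglyMeasurable, ?_⟩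
  rw [HasFiniteIntegral, Measure.volume_eq_prod, lintegral_prod _ hm.enorm.aemeasurable]
  refine (lintegral_mono fun z' => h (slice f z')
    ((measurable_slice hf.holomorphic).comp (measurable_const.prodMk measurable_id))
    (differentiableOn_slice hf.holomorphic z')).trans_lt ?_
  rw [lintegral_const_mul' _ _ hC]
  exact ENNReal.mul_lt_top hC.lt_top (lintegral_slice_lt_top hlam hf)

theorem integral_slice_line_eq_zero {m : ℕ} {lam : ℝ} (hlam : -1 < lam)
    {f : (Fin (m + 1) → ℂ) → ℂ} (hf : MemBergman m 1 lam f) {t : ℝ} (ht : 0 < t) :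
    ∫ p : (Fin m → ℂ) × ℝ, slice f p.1 (p.2 + t * Complex.I) = 0 := by
  have hH := measurable_lintegral_slice hf.holomorphic
  rw [Measure.volume_eq_prod, integral_prod _ (integrable_slice_line hlam hf ht)]
  refine integral_eq_zero_of_ae ?_
  have hK : Measurable fun z' : Fin m → ℂ => ∫⁻ y in Ioi (0 : ℝ), ENNReal.ofReal (y ^ lam) *
      ∫⁻ x : ℝ, ‖slice f z' (x + y * Complex.I)‖ₑ :=
    Measurable.lintegral_prod_right' (f := fun q : (Fin m → ℂ) × ℝ => ENNReal.ofReal (q.2 ^ lam) *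
      ∫⁻ x : ℝ, ‖slice f q.1 (x + q.2 * Complex.I)‖ₑ) (by fun_prop)
  filter_upwards [ae_lt_top hK (lintegral_slice_lt_top hlam hf).ne] with z' hz'
  exact integral_line_eq_zero lam
    ((measurable_slice hf.holomorphic).comp (measurable_const.prodMk measurable_id))
    (differentiableOn_slice hf.holomorphic z') hz' ht

/-! ### The integrals over the boundary and over the half-space -/

theorem measurableSet_boundary (m : ℕ) : MeasurableSet (boundary m) :=
  (isClosed_eq (continuous_rho m) continuous_const).measurableSet

theorem boundaryMeasure_restrict_boundary (m : ℕ) :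
    (boundaryMeasure m).restrict (boundary m) = boundaryMeasure m := by
  refine Measure.restrict_eq_self_of_ae_mem ?_
  refine (ae_map_iff (measurable_boundaryParam m).aemeasurable (measurableSet_boundary m)).2 ?_
  refine Filter.Eventually.of_forall fun p => ?_
  simpa [boundary] using rho_boundaryParam_add_smul_iPoint m p 0

theorem rho_add_smul_iPoint {m : ℕ} (u : Fin (m + 1) → ℂ) (t : ℝ) :
    rho (u + t • iPoint m) = rho u + t := by
  simp [rho, iPoint]
  ring

theorem integrableOn_boundary_and_integral_eq_zero {m : ℕ} {lam : ℝ} (hlam : -1 < lam)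
    {f : (Fin (m + 1) → ℂ) → ℂ} (hf : MemBergman m 1 lam f) {t : ℝ} (ht : 0 < t) :
    IntegrableOn (fun u => f (u + t • iPoint m)) (boundary m) (boundaryMeasure m) ∧
      ∫ u in boundary m, f (u + t • iPoint m) ∂(boundaryMeasure m) = 0 := by
  have hb := measurableSet_boundary m
  have heq : EqOn (fun u => (upperHalfSpace m).indicator f (u + t • iPoint m))
      (fun u => f (u + t • iPoint m)) (boundary m) := fun u hu => by
    refine indicator_of_mem ?_ f
    have hu : rho u = 0 := hu
    simpa [upperHalfSpace, rho_add_smul_iPoint, hu] using ht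
  have hm : Measurable fun u => (upperHalfSpace m).indicator f (u + t • iPoint m) :=
    (measurable_indicator_upperHalfSpace hf.holomorphic).comp (measurable_add_const _)
  rw [← integrableOn_congr_fun heq hb, ← setIntegral_congr_fun hb heq, IntegrableOn,
    boundaryMeasure_restrict_boundary, boundaryMeasure,
    integrable_map_measure hm.aestronglyMeasurable (measurable_boundaryParam m).aemeasurable,
    integral_map (measurable_boundaryParam m).aemeasurable hm.aestronglyMeasurable]
  simp only [Function.comp_def, ← slice_apply]
  exact ⟨integrable_slice_line hlam hf ht, integral_slice_line_eq_zero hlam hf ht⟩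

theorem integrableOn_upperHalfSpace_and_integral_eq_zero {m : ℕ} {lam : ℝ} (hlam : -1 < lam)
    {f : (Fin (m + 1) → ℂ) → ℂ} (hf : MemBergman m 1 lam f) :
    IntegrableOn f (upperHalfSpace m) (weightedVolume m lam) ∧
      ∫ z in upperHalfSpace m, f z ∂(weightedVolume m lam) = 0 := by
  have hU := (isOpen_upperHalfSpace m).measurableSet
  have hΨ := measurable_boundaryParam_add_smul_iPoint m
  have heq : EqOn ((upperHalfSpace m).indicator f) f (upperHalfSpace m) :=
    fun z hz => indicator_of_mem hz f
  have hm := measurable_indicator_upperHalfSpace hf.holomorphic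
  have hint : Integrable (fun q : ((Fin m → ℂ) × ℝ) × ℝ =>
      slice f q.1.1 (q.1.2 + q.2 * Complex.I)) (volume.prod (heightMeasure m lam)) :=
    ⟨(measurable_slice_coord hf.holomorphic).aestronglyMeasurable,
      lintegral_slice_heightMeasure_lt_top hf⟩
  rw [← integrableOn_congr_fun heq hU, ← setIntegral_congr_fun hU heq, IntegrableOn,
    weightedVolume_restrict_upperHalfSpace, weightedVolume_eq_map,
    integrable_map_measure hm.aestronglyMeasurable hΨ.aemeasurable,
    integral_map hΨ.aemeasurable hm.aestronglyMeasurable]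
  simp only [Function.comp_def, ← slice_apply]
  refine ⟨hint, ?_⟩
  -- With the height outermost, each inner integral is a boundary integral already known to vanish.
  rw [integral_prod_symm _ hint]
  refine integral_eq_zero_of_ae ?_
  have hpos : ∀ᵐ y ∂(heightMeasure m lam), 0 < y :=
    (withDensity_absolutelyContinuous _ _).ae_le (ae_restrict_mem measurableSet_Ioi)
  filter_upwards [hpos] with y hy
  exact integral_slice_line_eq_zero hlam hf hy

end Siegel

theorem mainTheorem7 (m : ℕ) (lam : ℝ) (hlam : -1 < lam) (f : (Fin (m + 1) → ℂ) → ℂ)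
    (hf : Siegel.MemBergman m 1 lam f) :
    (∀ t : ℝ, 0 < t →
      IntegrableOn (fun u => f (u + t • Siegel.iPoint m)) (Siegel.boundary m)
          (Siegel.boundaryMeasure m) ∧
        ∫ u in Siegel.boundary m, f (u + t • Siegel.iPoint m) ∂(Siegel.boundaryMeasure m) = 0) ∧
    IntegrableOn f (Siegel.upperHalfSpace m) (Siegel.weightedVolume m lam) ∧
      ∫ z in Siegel.upperHalfSpace m, f z ∂(Siegel.weightedVolume m lam) = 0 :=
  ⟨fun _ ht => Siegel.integrableOn_boundary_and_integral_eq_zero hlam hf ht,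
    Siegel.integrableOn_upperHalfSpace_and_integral_eq_zero hlam hf⟩
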